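/- Let $G$ be a finite group. Let $B(G)$ be the Burnside ring of $G$, that is, the Grothendieck ring of the commutative semiring of isomorphism classes of finite left $G$-sets under disjoint union and cartesian product. Let $\tilde B(G)$ be the ghost ring of $G$, that is, the ring (under pointwise operations) of all functions from the set of subgroups of $G$ to $\mathbb{Z}$ that are constant on conjugacy classes. For a finite $G$-set $S$ with stabilizers $G_s$ and a subgroup $U \le G$, the assignment $\chi_U(S) = \#\{s \in S \mid U \le G_s\}$ extends to a ring homomorphism $\chi_U : B(G) \to \mathbb{Z}$, and $B(G)$ is identified with its image in $\tilde B(G)$ under the injective ring homomorphism $x \mapsto (U \mapsto \chi_U(x))$. Let $\mathcal{U}$ be the family of all cyclic subgroups of $G$, and let $e_{\mathcal{U}} \in \tilde B(G)$ be given by $e_{\mathcal{U}}(U) = 1$ if $U$ is cyclic and $e_{\mathcal{U}}(U) = 0$ otherwise. Define the Artin exponent $$A(G, \mathcal{U}) = \min\{\, n \ge 1 \mid n \cdot e_{\mathcal{U}} \in B(G) \,\}.$$ Then $A(G, \mathcal{U}) = 1$ if and only if $G$ is cyclic. -/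

import Mathlib

universe u

/-! ### The Grothendieck ring of a commutative semiring -/

namespace GrothendieckRing

open Algebra

variable {R : Type*} [CommSemiring R]

theorem addHom_ext {A : Type*} [AddCommGroup A] {f g : GrothendieckAddGroup R →+ A}
    (h : ∀ r : R, f (GrothendieckAddGroup.of r) = g (GrothendieckAddGroup.of r)) : f = g :=
  GrothendieckAddGroup.lift.symm.injective (AddMonoidHom.ext h)

theorem lift_of {A : Type*} [AddCommGroup A] (f : R →+ A) (r : R) :
    GrothendieckAddGroup.lift f (GrothendieckAddGroup.of r) = f r :=
  DFunLike.congr_fun (GrothendieckAddGroup.lift.symm_apply_apply f) r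

/-- The multiplication of the Grothendieck ring: the biadditive extension of `(r, s) ↦ r * s`. -/
noncomputable def mulHom (R : Type*) [CommSemiring R] :
    GrothendieckAddGroup R →+ GrothendieckAddGroup R →+ GrothendieckAddGroup R :=
  GrothendieckAddGroup.lift
    { toFun := fun r => GrothendieckAddGroup.lift
        ((GrothendieckAddGroup.of : R →+ GrothendieckAddGroup R).comp (AddMonoidHom.mulLeft r))
      map_zero' := addHom_ext fun s => by
        simp only [lift_of]
        simp
      map_add' := fun a b => addHom_ext fun s => by
        simp only [lift_of, AddMonoidHom.add_apply]
        simp [add_mul] }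

theorem mulHom_of (r s : R) :
    mulHom R (GrothendieckAddGroup.of r) (GrothendieckAddGroup.of s)
      = GrothendieckAddGroup.of (r * s) := by
  rw [mulHom, lift_of]
  exact lift_of _ _

theorem mulHom_comm (x y : GrothendieckAddGroup R) : mulHom R x y = mulHom R y x := by
  have h : mulHom R = (mulHom R).flip :=
    addHom_ext fun r => addHom_ext fun s => by
      rw [AddMonoidHom.flip_apply, mulHom_of, mulHom_of, mul_comm]
  exact DFunLike.congr_fun (DFunLike.congr_fun h x) y

theorem mulHom_assoc (x y z : GrothendieckAddGroup R) :
    mulHom R (mulHom R x y) z = mulHom R x (mulHom R y z) := by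
  have h1 : ∀ (r s : R) (z : GrothendieckAddGroup R),
      mulHom R (mulHom R (GrothendieckAddGroup.of r) (GrothendieckAddGroup.of s)) z
        = mulHom R (GrothendieckAddGroup.of r) (mulHom R (GrothendieckAddGroup.of s) z) :=
    fun r s => DFunLike.congr_fun (f := mulHom R (mulHom R _ _))
      (g := (mulHom R (GrothendieckAddGroup.of r)).comp (mulHom R (GrothendieckAddGroup.of s)))
      (addHom_ext fun t => by simp only [AddMonoidHom.comp_apply, mulHom_of, mul_assoc])
  have h2 : ∀ (r : R) (y : GrothendieckAddGroup R),
      mulHom R (mulHom R (GrothendieckAddGroup.of r) y) z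
        = mulHom R (GrothendieckAddGroup.of r) (mulHom R y z) :=
    fun r => DFunLike.congr_fun
      (f := ((mulHom R).flip z).comp (mulHom R (GrothendieckAddGroup.of r)))
      (g := (mulHom R (GrothendieckAddGroup.of r)).comp ((mulHom R).flip z))
      (addHom_ext fun s => h1 r s z)
  exact DFunLike.congr_fun (f := ((mulHom R).flip z).comp ((mulHom R).flip y))
    (g := (mulHom R).flip (mulHom R y z)) (addHom_ext fun r => h2 r y) x

theorem one_mulHom (x : GrothendieckAddGroup R) :
    mulHom R (GrothendieckAddGroup.of 1) x = x := by
  have h : mulHom R (GrothendieckAddGroup.of 1) = AddMonoidHom.id _ :=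
    addHom_ext fun r => by rw [mulHom_of, one_mul, AddMonoidHom.id_apply]
  exact DFunLike.congr_fun h x

/-- The Grothendieck group of (the additive monoid of) a commutative semiring is a commutative
ring. -/
noncomputable instance instCommRing : CommRing (GrothendieckAddGroup R) where
  __ : AddCommGroup (GrothendieckAddGroup R) := inferInstance
  mul x y := mulHom R x y
  one := GrothendieckAddGroup.of 1
  left_distrib x y z := (mulHom R x).map_add y z
  right_distrib x y z := DFunLike.congr_fun ((mulHom R).map_add x y) z
  zero_mul x := DFunLike.congr_fun (mulHom R).map_zero x
  mul_zero x := (mulHom R x).map_zero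
  mul_assoc := mulHom_assoc
  one_mul := one_mulHom
  mul_one x := (mulHom_comm x _).trans (one_mulHom x)
  mul_comm := mulHom_comm

/-- A semiring homomorphism from `R` to a commutative ring extends to the Grothendieck ring. -/
noncomputable def lift {A : Type*} [CommRing A] (f : R →+* A) : GrothendieckAddGroup R →+* A where
  __ := GrothendieckAddGroup.lift f.toAddMonoidHom
  map_one' := (lift_of f.toAddMonoidHom 1).trans f.map_one
  map_mul' x y := by
    have h : (AddMonoidHom.compHom (GrothendieckAddGroup.lift f.toAddMonoidHom)).comp (mulHom R)
        = (AddMonoidHom.mul.compl₂ (GrothendieckAddGroup.lift f.toAddMonoidHom)).comp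
            (GrothendieckAddGroup.lift f.toAddMonoidHom) :=
      addHom_ext fun r => addHom_ext fun s => by
        simp only [AddMonoidHom.comp_apply, AddMonoidHom.compHom_apply_apply, mulHom_of,
          AddMonoidHom.compl₂_apply, lift_of, AddMonoidHom.mul_apply]
        exact f.map_mul r s
    exact DFunLike.congr_fun (DFunLike.congr_fun h x) y

end GrothendieckRing

/-! ### Finite `G`-sets and the Burnside ring -/

/-- A finite left `G`-set. -/
structure FiniteGSet (G : Type u) [Group G] : Type (u + 1) where
  carrier : Type u
  [action : MulAction G carrier]
  [finite : Finite carrier]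

namespace FiniteGSet

variable {G : Type u} [Group G]

attribute [instance] FiniteGSet.action FiniteGSet.finite

/-- Two finite `G`-sets are isomorphic when there is a `G`-equivariant bijection between them. -/
def Iso (X Y : FiniteGSet G) : Prop :=
  ∃ e : X.carrier ≃ Y.carrier, ∀ (g : G) (x : X.carrier), e (g • x) = g • e x

instance setoid (G : Type u) [Group G] : Setoid (FiniteGSet G) where
  r := Iso
  iseqv :=
    { refl := fun _ => ⟨Equiv.refl _, fun _ _ => rfl⟩
      symm := fun ⟨e, he⟩ => ⟨e.symm, fun g y => by
        rw [Equiv.symm_apply_eq, he, Equiv.apply_symm_apply]⟩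
      trans := fun ⟨e, he⟩ ⟨f, hf⟩ => ⟨e.trans f, fun g x => by
        simp only [Equiv.trans_apply, he, hf]⟩ }

/-- The empty `G`-set. -/
def empty (G : Type u) [Group G] : FiniteGSet G where
  carrier := PEmpty
  action := { smul := fun _ x => x, one_smul := fun _ => rfl, mul_smul := fun _ _ _ => rfl }

/-- The one-point `G`-set. -/
def point (G : Type u) [Group G] : FiniteGSet G where
  carrier := PUnit
  action := { smul := fun _ x => x, one_smul := fun _ => rfl, mul_smul := fun _ _ _ => rfl }

/-- Disjoint union, with `G` acting on each summand. -/
def sum (X Y : FiniteGSet G) : FiniteGSet G where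
  carrier := X.carrier ⊕ Y.carrier

/-- Cartesian product, with the diagonal action. -/
def prod (X Y : FiniteGSet G) : FiniteGSet G where
  carrier := X.carrier × Y.carrier

/-- The number of points of `X` whose stabilizer contains `U`. -/
noncomputable def mark (U : Subgroup G) (X : FiniteGSet G) : ℕ :=
  Nat.card {x : X.carrier // U ≤ MulAction.stabilizer G x}

theorem stabilizer_eq_of_equivariant {X Y : FiniteGSet G} (f : X.carrier → Y.carrier)
    (hf : ∀ (g : G) (x : X.carrier), f (g • x) = g • f x) (hinj : Function.Injective f)
    (x : X.carrier) : MulAction.stabilizer G (f x) = MulAction.stabilizer G x := by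
  ext g
  rw [MulAction.mem_stabilizer_iff, MulAction.mem_stabilizer_iff, ← hf, hinj.eq_iff]

theorem mark_congr (U : Subgroup G) {X Y : FiniteGSet G} (h : Iso X Y) : mark U X = mark U Y := by
  obtain ⟨e, he⟩ := h
  exact Nat.card_congr (e.subtypeEquiv fun x => by
    rw [stabilizer_eq_of_equivariant e he e.injective x])

theorem mark_empty (U : Subgroup G) : mark U (empty G) = 0 := by
  have : IsEmpty {x : (empty G).carrier // U ≤ MulAction.stabilizer G x} :=
    ⟨fun x => PEmpty.elim x.1⟩
  exact Nat.card_of_isEmpty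

theorem mark_point (U : Subgroup G) : mark U (point G) = 1 := by
  rw [mark, Nat.card_eq_one_iff_unique]
  exact ⟨⟨fun _ _ => Subtype.ext rfl⟩, ⟨⟨PUnit.unit, fun _ _ => rfl⟩⟩⟩

theorem mark_sum (U : Subgroup G) (X Y : FiniteGSet G) :
    mark U (sum X Y) = mark U X + mark U Y := by
  rw [mark, mark, mark, ← Nat.card_sum]
  refine Nat.card_congr (Equiv.subtypeSum.trans (Equiv.sumCongr ?_ ?_))
  · exact Equiv.subtypeEquivRight fun x => by
      rw [← stabilizer_eq_of_equivariant (X := X) (Y := sum X Y) Sum.inl (fun _ _ => rfl)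
        Sum.inl_injective x]
  · exact Equiv.subtypeEquivRight fun x => by
      rw [← stabilizer_eq_of_equivariant (X := Y) (Y := sum X Y) Sum.inr (fun _ _ => rfl)
        Sum.inr_injective x]

theorem mark_prod (U : Subgroup G) (X Y : FiniteGSet G) :
    mark U (prod X Y) = mark U X * mark U Y := by
  rw [mark, mark, mark, ← Nat.card_prod]
  refine Nat.card_congr ((Equiv.subtypeEquivRight fun x => ?_).trans Equiv.subtypeProdEquivProd)
  refine ⟨fun h => ⟨fun g hg => congrArg Prod.fst (h hg), fun g hg => congrArg Prod.snd (h hg)⟩,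
    fun h g hg => Prod.ext (h.1 hg) (h.2 hg)⟩

/-- Conjugate subgroups have the same mark. -/
theorem mark_conj (U : Subgroup G) (g : G) (X : FiniteGSet G) :
    mark (U.map (MulAut.conj g).toMonoidHom) X = mark U X := by
  refine (Nat.card_congr ((MulAction.toPerm g).subtypeEquiv fun x => ?_)).symm
  rw [MulAction.toPerm_apply, MulAction.stabilizer_smul_eq_stabilizer_map_conj]
  exact (Subgroup.map_le_map_iff_of_injective (MulAut.conj g).injective).symm

end FiniteGSet

/-- The isomorphism classes of finite `G`-sets. -/
def GSetClass (G : Type u) [Group G] : Type (u + 1) := Quotient (FiniteGSet.setoid G)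

namespace GSetClass

open FiniteGSet

variable {G : Type u} [Group G]

/-- The isomorphism class of a finite `G`-set. -/
def mk (X : FiniteGSet G) : GSetClass G := Quotient.mk _ X

theorem mk_eq {X Y : FiniteGSet G} (h : Iso X Y) : mk X = mk Y := Quotient.sound h

instance : Zero (GSetClass G) where
  zero := mk (FiniteGSet.empty G)

instance : One (GSetClass G) where
  one := mk (FiniteGSet.point G)

/-- Addition of classes is disjoint union. -/
instance : Add (GSetClass G) where
  add := Quotient.map₂ FiniteGSet.sum fun _ _ ⟨e, he⟩ _ _ ⟨f, hf⟩ =>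
    ⟨Equiv.sumCongr e f, by
      rintro g (x | x)
      · exact congrArg Sum.inl (he g x)
      · exact congrArg Sum.inr (hf g x)⟩

/-- Multiplication of classes is the cartesian product. -/
instance : Mul (GSetClass G) where
  mul := Quotient.map₂ FiniteGSet.prod fun _ _ ⟨e, he⟩ _ _ ⟨f, hf⟩ =>
    ⟨Equiv.prodCongr e f, fun g x => Prod.ext (he g x.1) (hf g x.2)⟩

/-- The commutative semiring of isomorphism classes of finite `G`-sets. -/
instance : CommSemiring (GSetClass G) where
  add_assoc := by
    rintro ⟨X⟩ ⟨Y⟩ ⟨Z⟩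
    exact mk_eq ⟨Equiv.sumAssoc _ _ _, by rintro g ((x | x) | x) <;> rfl⟩
  zero_add := by
    rintro ⟨X⟩
    exact mk_eq ⟨Equiv.emptySum PEmpty _, by rintro g (x | x) <;> [cases x; rfl]⟩
  add_zero := by
    rintro ⟨X⟩
    exact mk_eq ⟨Equiv.sumEmpty _ PEmpty, by rintro g (x | x) <;> [rfl; cases x]⟩
  add_comm := by
    rintro ⟨X⟩ ⟨Y⟩
    exact mk_eq ⟨Equiv.sumComm _ _, by rintro g (x | x) <;> rfl⟩
  nsmul := nsmulRec
  left_distrib := by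
    rintro ⟨X⟩ ⟨Y⟩ ⟨Z⟩
    exact mk_eq ⟨Equiv.prodSumDistrib _ _ _, by rintro g ⟨x, y | y⟩ <;> rfl⟩
  right_distrib := by
    rintro ⟨X⟩ ⟨Y⟩ ⟨Z⟩
    exact mk_eq ⟨Equiv.sumProdDistrib _ _ _, by rintro g ⟨x | x, y⟩ <;> rfl⟩
  zero_mul := by
    rintro ⟨X⟩
    exact mk_eq ⟨Equiv.pemptyProd _, fun _ x => PEmpty.elim x.1⟩
  mul_zero := by
    rintro ⟨X⟩
    exact mk_eq ⟨Equiv.prodPEmpty _, fun _ x => PEmpty.elim x.2⟩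
  mul_assoc := by
    rintro ⟨X⟩ ⟨Y⟩ ⟨Z⟩
    exact mk_eq ⟨Equiv.prodAssoc _ _ _, fun _ _ => rfl⟩
  one_mul := by
    rintro ⟨X⟩
    exact mk_eq ⟨Equiv.punitProd _, fun _ _ => rfl⟩
  mul_one := by
    rintro ⟨X⟩
    exact mk_eq ⟨Equiv.prodPUnit _, fun _ _ => rfl⟩
  mul_comm := by
    rintro ⟨X⟩ ⟨Y⟩
    exact mk_eq ⟨Equiv.prodComm _ _, fun _ _ => rfl⟩

/-- The semiring homomorphism `[X] ↦ #{x ∈ X | U ≤ G_x}`. -/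
noncomputable def mark (U : Subgroup G) : GSetClass G →+* ℤ where
  toFun := Quotient.lift (fun X => (FiniteGSet.mark U X : ℤ)) fun _ _ h =>
    congrArg Nat.cast (FiniteGSet.mark_congr U h)
  map_zero' := congrArg Nat.cast (FiniteGSet.mark_empty U)
  map_one' := (congrArg Nat.cast (FiniteGSet.mark_point U)).trans Nat.cast_one
  map_add' := by
    rintro ⟨X⟩ ⟨Y⟩
    exact (congrArg Nat.cast (FiniteGSet.mark_sum U X Y)).trans (Nat.cast_add _ _)
  map_mul' := by
    rintro ⟨X⟩ ⟨Y⟩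
    exact (congrArg Nat.cast (FiniteGSet.mark_prod U X Y)).trans (Nat.cast_mul _ _)

theorem mark_conj (U : Subgroup G) (g : G) :
    mark (U.map (MulAut.conj g).toMonoidHom) = mark U := by
  ext x
  obtain ⟨X⟩ := x
  exact congrArg Nat.cast (FiniteGSet.mark_conj U g X)

end GSetClass

/-- The Burnside ring `B(G)`: the Grothendieck ring of the semiring of isomorphism classes of
finite `G`-sets. -/
abbrev BurnsideRing (G : Type u) [Group G] : Type (u + 1) :=
  Algebra.GrothendieckAddGroup (GSetClass G)

/-- The ring homomorphism `χ_U : B(G) → ℤ`. -/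
noncomputable def burnsideMark {G : Type u} [Group G] (U : Subgroup G) : BurnsideRing G →+* ℤ :=
  GrothendieckRing.lift (GSetClass.mark U)

/-! ### The ghost ring and the Artin exponent -/

/-- The ghost ring of `G`: the integer-valued functions on the set of subgroups of `G` that are
constant on conjugacy classes (a product of copies of `ℤ`, one for each conjugacy class of
subgroups). -/
def GhostRing (G : Type u) [Group G] : Subring (Subgroup G → ℤ) where
  carrier := {f | ∀ (U : Subgroup G) (g : G), f (U.map (MulAut.conj g).toMonoidHom) = f U}
  mul_mem' ha hb U g := congrArg₂ (· * ·) (ha U g) (hb U g)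
  one_mem' _ _ := rfl
  add_mem' ha hb U g := congrArg₂ (· + ·) (ha U g) (hb U g)
  zero_mem' _ _ := rfl
  neg_mem' ha U g := congrArg Neg.neg (ha U g)

/-- The canonical ring homomorphism `χ : B(G) → B̃(G)`, `x ↦ (U ↦ χ_U(x))`. -/
noncomputable def ghostMap (G : Type u) [Group G] : BurnsideRing G →+* GhostRing G :=
  (RingHom.pi fun U : Subgroup G => burnsideMark U).codRestrict (GhostRing G) fun x U g => by
    change burnsideMark (U.map (MulAut.conj g).toMonoidHom) x = burnsideMark U x
    rw [burnsideMark, burnsideMark, GSetClass.mark_conj]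

/-- The element of the ghost ring that is `1` on the cyclic subgroups and `0` on the others. -/
noncomputable def cyclicIndicator (G : Type u) [Group G] : GhostRing G :=
  open Classical in
  ⟨fun U => if IsCyclic U then 1 else 0, fun U g => by
    have h := (U.equivMapOfInjective (MulAut.conj g).toMonoidHom (MulAut.conj g).injective).isCyclic
    classical exact if_congr h.symm rfl rfl⟩

/-- The Artin exponent of `G` with respect to the family of all cyclic subgroups: the least
positive integer `n` such that `n • e` lies in the image of `B(G)` in the ghost ring, where `e` is
the indicator of the cyclic subgroups. -/
noncomputable def artinExponent (G : Type u) [Group G] : ℕ :=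
  sInf {n : ℕ | 0 < n ∧ n • cyclicIndicator G ∈ (ghostMap G).range}

/-! If `G` is cyclic, so are all its subgroups, and the indicator is the identity of the ghost ring.
Conversely, elements of the Burnside ring satisfy congruences: when a `p`-subgroup `P` normalizes
`N`, the marks at `N` and `PN` agree modulo `p` (`burnsideMark_sup_cast`). If `G` is not cyclic, a
minimal noncyclic subgroup `K` has only cyclic proper subgroups, hence is solvable, hence is `PN`
with `N` proper and normal and `P` a `p`-group. The indicator takes the value 1 at `N` and 0 at `K`,
which violates the congruence, so it is not in the Burnside ring. -/

/-- A finite group all of whose proper subgroups are cyclic is solvable. -/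
theorem isSolvable_of_forall_isCyclic {H : Type*} [Group H] [Finite H]
    (h : ∀ L : Subgroup H, L ≠ ⊤ → IsCyclic L) : Group.IsSolvable H := by
  by_cases hp : ∃ p : ℕ, p.Prime ∧ IsPGroup p H
  · obtain ⟨p, hp, hH⟩ := hp
    have : Fact p.Prime := ⟨hp⟩
    have : Group.IsNilpotent H := hH.isNilpotent
    infer_instance
  -- Outside the `p`-group case every Sylow subgroup is proper, hence cyclic, and groups with cyclic
  -- Sylow subgroups are solvable.
  · have : IsZGroup H := ⟨fun p hprime P => h P fun hP =>
      hp ⟨p, hprime, (hP ▸ P.isPGroup').of_equiv Subgroup.topEquiv⟩⟩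
    infer_instance

/-- A nontrivial finite solvable group is the product of a proper normal subgroup and a
`p`-subgroup for some prime `p`. -/
theorem exists_normal_sup_isPGroup_eq_top (H : Type*) [Group H] [Finite H] [Nontrivial H]
    [Group.IsSolvable H] :
    ∃ (p : ℕ) (N P : Subgroup H), p.Prime ∧ N.Normal ∧ N ≠ ⊤ ∧ IsPGroup p P ∧ P ⊔ N = ⊤ := by
  obtain h | ⟨N, hN, hle⟩ := eq_top_or_exists_le_coatom (commutator H)
  · exact absurd h (Group.IsSolvable.commutator_lt_top_of_nontrivial H).ne
  · have hnormal : N.Normal := Subgroup.Normal.of_commutator_le H hle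
    obtain ⟨p, hp, hdvd⟩ := Nat.exists_prime_and_dvd (mt Subgroup.index_eq_one.mp hN.1)
    have : Fact p.Prime := ⟨hp⟩
    let P : Sylow p H := default
    refine ⟨p, N, P, hp, hnormal, hN.1, P.isPGroup', ?_⟩
    rw [sup_comm]
    -- By maximality of `N` it suffices that the Sylow subgroup `P` is not inside `N`; otherwise
    -- `p`, which divides the index of `N`, would divide that of `P`.
    refine hN.2 _ (left_lt_sup.mpr fun hPN => ?_)
    exact P.not_dvd_index (hdvd.trans (Subgroup.index_dvd_of_le hPN))

namespace FiniteGSet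

variable {G : Type u} [Group G]

/-- If a `p`-subgroup `P` normalizes `N`, then the marks at `P ⊔ N` and `N` agree modulo `p`. -/
theorem mark_sup_modEq {p : ℕ} [Fact p.Prime] {P N : Subgroup G} [Finite P] (hP : IsPGroup p P)
    (hPN : P ≤ Subgroup.normalizer N) (X : FiniteGSet G) : 
    mark N X ≡ mark (P ⊔ N) X [MOD p] := by
  -- For `n` in `N` and `g` in `P`, the element `g⁻¹ng` lies in `N` and fixes `x`, so `n` fixes
  -- `gx`: thus `P` permutes the `N`-fixed points.
  let act : MulAction P {x : X.carrier // N ≤ MulAction.stabilizer G x} :=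
    { smul := fun g x => ⟨(g : G) • x.1, fun n hn => by
        have h := x.2 (((Subgroup.mem_normalizer_iff''.mp (hPN g.2)) n).mp hn)
        rw [MulAction.mem_stabilizer_iff] at h ⊢
        rwa [mul_smul, mul_smul, inv_smul_eq_iff] at h⟩
      one_smul := fun x => Subtype.ext (one_smul G x.1)
      mul_smul := fun g h x => Subtype.ext (mul_smul (g : G) (h : G) x.1) }
  have e : MulAction.fixedPoints P {x : X.carrier // N ≤ MulAction.stabilizer G x} ≃
      {x : X.carrier // P ⊔ N ≤ MulAction.stabilizer G x} :=
    { toFun := fun x => ⟨x.1.1, sup_le (fun g hg => congrArg Subtype.val (x.2 ⟨g, hg⟩)) x.1.2⟩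
      invFun := fun x => ⟨⟨x.1, le_sup_right.trans x.2⟩, fun g => Subtype.ext
        (le_sup_left.trans x.2 g.2)⟩
      left_inv := fun _ => rfl
      right_inv := fun _ => rfl }
  rw [mark, mark, ← Nat.card_congr e]
  exact hP.card_modEq_card_fixedPoints _

end FiniteGSet

/-- If a `p`-subgroup `P` normalizes `N`, then `χ_{PN}` and `χ_N` agree modulo `p`. -/
theorem burnsideMark_sup_cast {G : Type u} [Group G] {p : ℕ} [Fact p.Prime] {P N : Subgroup G}
    [Finite P] (hP : IsPGroup p P) (hPN : P ≤ Subgroup.normalizer N) (x : BurnsideRing G) :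
    (burnsideMark N x : ZMod p) = burnsideMark (P ⊔ N) x := by
  have h : (Int.castAddHom (ZMod p)).comp (burnsideMark N).toAddMonoidHom =
      (Int.castAddHom (ZMod p)).comp (burnsideMark (P ⊔ N)).toAddMonoidHom := by
    -- Both sides are additive in `x`, so actual `G`-sets suffice.
    refine GrothendieckRing.addHom_ext fun r => ?_
    obtain ⟨X⟩ := r
    have hmark (U : Subgroup G) : burnsideMark U (Algebra.GrothendieckAddGroup.of
        (GSetClass.mk X)) = FiniteGSet.mark U X :=
      GrothendieckRing.lift_of (GSetClass.mark U).toAddMonoidHom _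
    change ((burnsideMark N (Algebra.GrothendieckAddGroup.of (GSetClass.mk X)) : ℤ) : ZMod p) =
      (burnsideMark (P ⊔ N) (Algebra.GrothendieckAddGroup.of (GSetClass.mk X)) : ℤ)
    rw [hmark, hmark, Int.cast_natCast, Int.cast_natCast, ZMod.natCast_eq_natCast_iff]
    exact FiniteGSet.mark_sup_modEq hP hPN X
  exact DFunLike.congr_fun h x

/-- The indicator of the cyclic subgroups lies in the Burnside ring only for cyclic groups. -/
theorem isCyclic_of_cyclicIndicator_mem_range {G : Type u} [Group G] [Finite G]
    (h : cyclicIndicator G ∈ (ghostMap G).range) : IsCyclic G := by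
  classical
  obtain ⟨x, hx⟩ := h
  have hval (U : Subgroup G) : burnsideMark U x = if IsCyclic U then 1 else 0 := by
    have hU : burnsideMark U x = (cyclicIndicator G).1 U :=
      congrFun (congrArg Subtype.val hx) U
    rw [hU, cyclicIndicator]
  by_contra hG
  have hne : ¬ IsCyclic (⊤ : Subgroup G) := fun _ => hG (Subgroup.topEquiv.isCyclic.mp ‹_›)
  obtain ⟨K, hK, hmin⟩ := wellFounded_lt.has_min {K : Subgroup G | ¬ IsCyclic K} ⟨⊤, hne⟩
  have hproper (L : Subgroup K) (hL : L ≠ ⊤) : IsCyclic (L.map K.subtype) := by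
    by_contra hc
    refine hmin _ hc (lt_of_le_of_ne (Subgroup.map_subtype_le L) fun heq => hL ?_)
    rw [eq_top_iff, ← Subgroup.map_subtype_le_map_subtype, heq]
    exact Subgroup.map_subtype_le _
  have hequiv (L : Subgroup K) := L.equivMapOfInjective K.subtype K.subtype_injective
  have : Group.IsSolvable K :=
    isSolvable_of_forall_isCyclic fun L hL => (hequiv L).isCyclic.mpr (hproper L hL)
  have : Nontrivial K := not_subsingleton_iff_nontrivial.mp fun _ => hK inferInstance
  obtain ⟨p, N, P, hp, hN, hNtop, hP, hsup⟩ := exists_normal_sup_isPGroup_eq_top K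
  have : Fact p.Prime := ⟨hp⟩
  have hnorm : P.map K.subtype ≤ Subgroup.normalizer (N.map K.subtype) := 
    (Subgroup.map_mono (le_top.trans_eq (Subgroup.normalizer_eq_top N).symm)).trans
      (Subgroup.le_normalizer_map _)
  -- Inside `G` the subgroup `PN` is `K` itself, so the congruence reads `1 = 0` in `ZMod p`.
  have key := burnsideMark_sup_cast (hP.map K.subtype) hnorm x
  rw [← Subgroup.map_sup, hsup, ← MonoidHom.range_eq_map, Subgroup.range_subtype, hval, hval,
    if_pos (hproper N hNtop), if_neg hK, Int.cast_one, Int.cast_zero] at key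
  exact one_ne_zero key

theorem cyclicIndicator_eq_one (G : Type u) [Group G] [IsCyclic G] : cyclicIndicator G = 1 :=
  Subtype.ext (funext fun _ => if_pos (Subgroup.isCyclic _))

theorem theorem4p1 (G : Type u) [Group G] [Finite G] :
    artinExponent G = 1 ↔ IsCyclic G := by
  refine ⟨fun h => ?_, fun h => ?_⟩
  -- The infimum of the empty set is 0, so the value 1 shows that the minimum is attained.
  · have hmem := Nat.sInf_mem (Nat.nonempty_of_sInf_eq_succ h)
    rw [← artinExponent, h] at hmem
    exact isCyclic_of_cyclicIndicator_mem_range (by simpa using hmem.2)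
  · have hmem : 1 ∈ {n : ℕ | 0 < n ∧ n • cyclicIndicator G ∈ (ghostMap G).range} :=
      ⟨one_pos, by rw [cyclicIndicator_eq_one, one_nsmul]; exact one_mem _⟩
    exact le_antisymm (Nat.sInf_le hmem) (Nat.sInf_mem ⟨1, hmem⟩).1
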